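/- Let $\mathbf{C}$ be the natural deduction system for classical propositional logic (formulas built from atomic formulas by $\neg,\supset,\land,\lor$) whose deductions are trees of formula occurrences. Their leaves are assumptions, each belonging to an assumption class (a formula together with a natural number label), and they are generated by the following rules, where $[X]\,C$ means that assumptions in one class of the form $X$ above that premise $C$ are discharged, and $C$ is arbitrary: - $\land I$: from $A$, $B$ and $[A\land B]\,C$ infer $C$; $\quad\land E$: from $A\land B$ and $[A][B]\,C$ infer $C$; - $\lor I$: from $A$ and $[A\lor B]\,C$ infer $C$; from $B$ and $[A\lor B]\,C$ infer $C$; $\quad\lor E$: from $A\lor B$, $[A]\,C$ and $[B]\,C$ infer $C$; - $\supset I$: from $B$ and $[A\supset B]\,C$ infer $C$; $\quad TR$ (Tarski's Rule): from $[A]\,C$ and $[A\supset B]\,C$ infer $C$; $\quad\supset E$: from $A\supset B$, $A$ and $[B]\,C$ infer $C$; - $\neg I$: from $[A]\,C$ and $[\neg A]\,C$ infer $C$; $\quad\neg E$: from $\neg A$ and $A$ infer $C$. Discharged classes may be empty (vacuous discharge). A deduction has no vacuous discharge if every application of a rule discharges at least one assumption above each of its premises $C$ above which it may discharge. A deduction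 has the subformula property if every formula occurring on it is a subformula of its conclusion or of one of its undischarged assumptions. **Corollary.** For every deduction of a formula $A$ in $\mathbf{C}$: 1. there is a deduction of $A$ in $\mathbf{C}$ from exactly the same undischarged assumptions (the same assumption classes) that has the subformula property; 2. there is a deduction of $A$ in $\mathbf{C}$ without vacuous discharge, all of whose undischarged assumptions are among those of the given deduction, that has the subformula property. In particular, whenever $\Gamma\vdash_{\mathbf{C}}A$ (there is a deduction of $A$ from some of the formulas in $\Gamma$), there is a deduction of $A$ from some of the formulas in $\Gamma$ that has the subformula property, and it can be chosen without vacuous discharge. -/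

import Mathlib

universe u

namespace SystemC

/-- Formulas of classical propositional logic over a type `α` of atomic formulas, with the
primitive connectives negation, implication, conjunction and disjunction. -/
inductive Formula (α : Type u) : Type u
  | atom (p : α) : Formula α
  | neg (A : Formula α) : Formula α
  | imp (A B : Formula α) : Formula α
  | and (A B : Formula α) : Formula α
  | or (A B : Formula α) : Formula α

/-- The set of subformulas of a formula; it contains the formula itself. -/
def Formula.subformulas {α : Type u} : Formula α → Set (Formula α)
  | .atom p => {.atom p}
  | .neg A => insert (.neg A) A.subformulas
  | .imp A B => insert (.imp A B) (A.subformulas ∪ B.subformulas)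
  | .and A B => insert (.and A B) (A.subformulas ∪ B.subformulas)
  | .or A B => insert (.or A B) (A.subformulas ∪ B.subformulas)

/-- `Deduction C` is the type of deductions in the system **C** with conclusion `C`.

A leaf `assume A n` is an occurrence of the assumption `A` with label `n`; the pair `(A, n)` is its
assumption class, so occurrences of different formulas always lie in different classes. The numbers
`i`, `j` at a rule are the labels of the classes it discharges; which formulas are discharged, and
above which premises, is recorded in `Deduction.undischarged`. A class that a rule discharges may be
empty (vacuous discharge). Premises are listed from left to right. -/
inductive Deduction {α : Type u} : Formula α → Type u
  | assume (A : Formula α) (n : ℕ) : Deduction A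
  /-- From `A`, `B` and `C`, infer `C`, discharging `(A ∧ B, i)` above `C`. -/
  | andI {A B C : Formula α} (i : ℕ)
      (dA : Deduction A) (dB : Deduction B) (dC : Deduction C) : Deduction C
  /-- From `A ∧ B` and `C`, infer `C`, discharging `(A, i)` and `(B, j)` above `C`. -/
  | andE {A B C : Formula α} (i j : ℕ)
      (dM : Deduction (.and A B)) (dC : Deduction C) : Deduction C
  /-- From `A` and `C`, infer `C`, discharging `(A ∨ B, i)` above `C`. -/
  | orIl {A B C : Formula α} (i : ℕ)
      (dA : Deduction A) (dC : Deduction C) : Deduction C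
  /-- From `B` and `C`, infer `C`, discharging `(A ∨ B, i)` above `C`. -/
  | orIr {A B C : Formula α} (i : ℕ)
      (dB : Deduction B) (dC : Deduction C) : Deduction C
  /-- From `A ∨ B`, `C` and `C`, infer `C`, discharging `(A, i)` above the first `C` and `(B, j)`
  above the second. -/
  | orE {A B C : Formula α} (i j : ℕ)
      (dM : Deduction (.or A B)) (dC₁ dC₂ : Deduction C) : Deduction C
  /-- From `B` and `C`, infer `C`, discharging `(A ⊃ B, i)` above `C`. -/
  | impI {A B C : Formula α} (i : ℕ)
      (dB : Deduction B) (dC : Deduction C) : Deduction C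
  /-- Tarski's Rule: from `C` and `C`, infer `C`, discharging `(A, i)` above the first `C` and
  `(A ⊃ B, j)` above the second. -/
  | tr {A B C : Formula α} (i j : ℕ)
      (dC₁ dC₂ : Deduction C) : Deduction C
  /-- From `A ⊃ B`, `A` and `C`, infer `C`, discharging `(B, i)` above `C`. -/
  | impE {A B C : Formula α} (i : ℕ)
      (dM : Deduction (.imp A B)) (dA : Deduction A) (dC : Deduction C) : Deduction C
  /-- From `C` and `C`, infer `C`, discharging `(A, i)` above the first `C` and `(¬ A, j)` above the
  second. -/
  | negI {A C : Formula α} (i j : ℕ)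
      (dC₁ dC₂ : Deduction C) : Deduction C
  /-- From `¬ A` and `A`, infer any `C`. -/
  | negE {A C : Formula α}
      (dM : Deduction (.neg A)) (dA : Deduction A) : Deduction C

namespace Deduction

variable {α : Type u}

/-- The assumption classes of the undischarged assumptions of a deduction. -/
def undischarged : {C : Formula α} → Deduction C → Set (Formula α × ℕ)
  | _, .assume A n => {(A, n)}
  | _, .andI (A := A) (B := B) i dA dB dC =>
      dA.undischarged ∪ dB.undischarged ∪ (dC.undischarged \ {(.and A B, i)})
  | _, .andE (A := A) (B := B) i j dM dC =>
      dM.undischarged ∪ (dC.undischarged \ {(A, i), (B, j)})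
  | _, .orIl (A := A) (B := B) i dA dC =>
      dA.undischarged ∪ (dC.undischarged \ {(.or A B, i)})
  | _, .orIr (A := A) (B := B) i dB dC =>
      dB.undischarged ∪ (dC.undischarged \ {(.or A B, i)})
  | _, .orE (A := A) (B := B) i j dM dC₁ dC₂ =>
      dM.undischarged ∪ (dC₁.undischarged \ {(A, i)}) ∪ (dC₂.undischarged \ {(B, j)})
  | _, .impI (A := A) (B := B) i dB dC =>
      dB.undischarged ∪ (dC.undischarged \ {(.imp A B, i)})
  | _, .tr (A := A) (B := B) i j dC₁ dC₂ =>
      (dC₁.undischarged \ {(A, i)}) ∪ (dC₂.undischarged \ {(.imp A B, j)})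
  | _, .impE (B := B) i dM dA dC =>
      dM.undischarged ∪ dA.undischarged ∪ (dC.undischarged \ {(B, i)})
  | _, .negI (A := A) i j dC₁ dC₂ =>
      (dC₁.undischarged \ {(A, i)}) ∪ (dC₂.undischarged \ {(.neg A, j)})
  | _, .negE dM dA => dM.undischarged ∪ dA.undischarged

/-- The formulas that occur on a deduction, i.e. at some node of the tree. -/
def formulas : {C : Formula α} → Deduction C → Set (Formula α)
  | _, .assume A _ => {A}
  | C, .andI _ dA dB dC => insert C (dA.formulas ∪ dB.formulas ∪ dC.formulas)
  | C, .andE _ _ dM dC => insert C (dM.formulas ∪ dC.formulas)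
  | C, .orIl _ dA dC => insert C (dA.formulas ∪ dC.formulas)
  | C, .orIr _ dB dC => insert C (dB.formulas ∪ dC.formulas)
  | C, .orE _ _ dM dC₁ dC₂ => insert C (dM.formulas ∪ dC₁.formulas ∪ dC₂.formulas)
  | C, .impI _ dB dC => insert C (dB.formulas ∪ dC.formulas)
  | C, .tr _ _ dC₁ dC₂ => insert C (dC₁.formulas ∪ dC₂.formulas)
  | C, .impE _ dM dA dC => insert C (dM.formulas ∪ dA.formulas ∪ dC.formulas)
  | C, .negI _ _ dC₁ dC₂ => insert C (dC₁.formulas ∪ dC₂.formulas)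
  | C, .negE dM dA => insert C (dM.formulas ∪ dA.formulas)

/-- A deduction has no vacuous discharge if, above every arbitrary premise of every application of a
rule in it, that application really discharges an assumption (for conjunction elimination, it is
enough that one of the two assumption classes is non-empty). -/
def NoVacuousDischarge : {C : Formula α} → Deduction C → Prop
  | _, .assume _ _ => True
  | _, .andI (A := A) (B := B) i dA dB dC =>
      (.and A B, i) ∈ dC.undischarged ∧
        dA.NoVacuousDischarge ∧ dB.NoVacuousDischarge ∧ dC.NoVacuousDischarge
  | _, .andE (A := A) (B := B) i j dM dC =>
      ((A, i) ∈ dC.undischarged ∨ (B, j) ∈ dC.undischarged) ∧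
        dM.NoVacuousDischarge ∧ dC.NoVacuousDischarge
  | _, .orIl (A := A) (B := B) i dA dC =>
      (.or A B, i) ∈ dC.undischarged ∧ dA.NoVacuousDischarge ∧ dC.NoVacuousDischarge
  | _, .orIr (A := A) (B := B) i dB dC =>
      (.or A B, i) ∈ dC.undischarged ∧ dB.NoVacuousDischarge ∧ dC.NoVacuousDischarge
  | _, .orE (A := A) (B := B) i j dM dC₁ dC₂ =>
      (A, i) ∈ dC₁.undischarged ∧ (B, j) ∈ dC₂.undischarged ∧
        dM.NoVacuousDischarge ∧ dC₁.NoVacuousDischarge ∧ dC₂.NoVacuousDischarge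
  | _, .impI (A := A) (B := B) i dB dC =>
      (.imp A B, i) ∈ dC.undischarged ∧ dB.NoVacuousDischarge ∧ dC.NoVacuousDischarge
  | _, .tr (A := A) (B := B) i j dC₁ dC₂ =>
      (A, i) ∈ dC₁.undischarged ∧ (.imp A B, j) ∈ dC₂.undischarged ∧
        dC₁.NoVacuousDischarge ∧ dC₂.NoVacuousDischarge
  | _, .impE (B := B) i dM dA dC =>
      (B, i) ∈ dC.undischarged ∧
        dM.NoVacuousDischarge ∧ dA.NoVacuousDischarge ∧ dC.NoVacuousDischarge
  | _, .negI (A := A) i j dC₁ dC₂ =>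
      (A, i) ∈ dC₁.undischarged ∧ (.neg A, j) ∈ dC₂.undischarged ∧
        dC₁.NoVacuousDischarge ∧ dC₂.NoVacuousDischarge
  | _, .negE dM dA => dM.NoVacuousDischarge ∧ dA.NoVacuousDischarge

/-- A deduction has the subformula property if every formula on it is a subformula of its conclusion
or of one of its undischarged assumptions. -/
def SubformulaProperty {C : Formula α} (d : Deduction C) : Prop :=
  ∀ F ∈ d.formulas, F ∈ C.subformulas ∨ ∃ a ∈ d.undischarged, F ∈ a.1.subformulas

end Deduction

end SystemC

/-!
The proof is semantic. Deductions are sound for two-valued valuations, so the undischarged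
assumptions of the given deduction entail its conclusion. Conversely, **C** is complete within any
finite set `S` of formulas that is closed under subformulas, using only deductions without vacuous
discharge on which all formulas belong to `S` (`Derivable.of_entails`): a maximal `Δ ⊆ S` from which
`C` is not derivable is the set of formulas in `S` that are true under some valuation. Each rule of
**C** gives one of the closure conditions needed for this (`Unprovable.mem_iff_eval`),
without any appeal to cut. Vacuous discharge never has to be used: if a premise `C` does not use an
assumption that the rule could discharge above it, the deduction of that premise already is a
deduction of the conclusion. Labels cause no trouble either, because one label can be fixed for each
formula throughout.

For the second claim, completeness is applied to a *minimal* set `Γ` of the given assumption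
formulas that entails the conclusion, with `S` the subformulas of `Γ` and of the conclusion. By
soundness and minimality the resulting deduction uses all of `Γ`, so membership in `S` is the
subformula property. For the first claim, the missing assumption classes are then added one at a
time as premises of implication introductions with vacuous discharge
(`Deduction.exists_undischarged_eq_union`).
-/

namespace SystemC

open Set

variable {α : Type u}

/-! ### Subformulas and valuations -/

namespace Formula

theorem self_mem_subformulas (A : Formula α) : A ∈ A.subformulas := by
  cases A <;> simp [subformulas]

theorem subformulas_subset {A B : Formula α} (h : A ∈ B.subformulas) :
    A.subformulas ⊆ B.subformulas := by
  induction B with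
  | atom p =>
    obtain rfl : A = .atom p := h
    exact Subset.rfl
  | neg B ih =>
    rcases h with rfl | h
    · exact Subset.rfl
    · exact (ih h).trans (subset_insert _ _)
  | imp B C ihB ihC | and B C ihB ihC | or B C ihB ihC =>
    rcases h with rfl | h | h
    · exact Subset.rfl
    · exact ((ihB h).trans subset_union_left).trans (subset_insert _ _)
    · exact ((ihC h).trans subset_union_right).trans (subset_insert _ _)

theorem finite_subformulas (A : Formula α) : A.subformulas.Finite := by
  induction A with
  | atom p => exact finite_singleton _
  | neg A ih => exact ih.insert _
  | imp A B ihA ihB | and A B ihA ihB | or A B ihA ihB => exact (ihA.union ihB).insert _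

/-- Truth of a formula under the valuation `v` of the atomic formulas. -/
def eval (v : α → Prop) : Formula α → Prop
  | .atom p => v p
  | .neg A => ¬ A.eval v
  | .imp A B => A.eval v → B.eval v
  | .and A B => A.eval v ∧ B.eval v
  | .or A B => A.eval v ∨ B.eval v

/-- Classical semantic consequence. -/
def Entails (Γ : Set (Formula α)) (C : Formula α) : Prop :=
  ∀ v : α → Prop, (∀ X ∈ Γ, X.eval v) → C.eval v

/-- The subformulas of the formulas in `Γ` and of `C`. -/
def closure (Γ : Set (Formula α)) (C : Formula α) : Set (Formula α) :=
  ⋃ X ∈ insert C Γ, X.subformulas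

theorem subset_closure (Γ : Set (Formula α)) (C : Formula α) : insert C Γ ⊆ closure Γ C :=
  fun X hX => mem_biUnion hX X.self_mem_subformulas

theorem subformulas_subset_closure {Γ : Set (Formula α)} {C X : Formula α}
    (hX : X ∈ closure Γ C) : X.subformulas ⊆ closure Γ C := by
  obtain ⟨Y, hY, h⟩ := mem_iUnion₂.1 hX
  exact (subformulas_subset h).trans (subset_biUnion_of_mem (u := subformulas) hY)

theorem finite_closure {Γ : Set (Formula α)} (hΓ : Γ.Finite) (C : Formula α) :
    (closure Γ C).Finite :=
  (hΓ.insert C).biUnion fun X _ => X.finite_subformulas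

end Formula

open Formula

/-! ### Soundness -/

namespace Deduction

theorem finite_undischarged {C : Formula α} (d : Deduction C) : d.undischarged.Finite := by
  induction d with
  | assume => exact finite_singleton _
  | andI _ _ _ _ ihA ihB ihC => exact (ihA.union ihB).union ihC.sdiff
  | andE _ _ _ _ ihM ihC => exact ihM.union ihC.sdiff
  | orIl _ _ _ ih ihC | orIr _ _ _ ih ihC | impI _ _ _ ih ihC => exact ih.union ihC.sdiff
  | orE _ _ _ _ _ ihM ih₁ ih₂ => exact (ihM.union ih₁.sdiff).union ih₂.sdiff
  | tr _ _ _ _ ih₁ ih₂ | negI _ _ _ _ ih₁ ih₂ => exact ih₁.sdiff.union ih₂.sdiff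
  | impE _ _ _ _ ihM ihA ihC => exact (ihM.union ihA).union ihC.sdiff
  | negE _ _ ihM ihA => exact ihM.union ihA

theorem eval_of_eval_undischarged {C : Formula α} (d : Deduction C) (v : α → Prop)
    (h : ∀ a ∈ d.undischarged, a.1.eval v) : C.eval v := by
  have discharge : ∀ {U : Set (Formula α × ℕ)} {X : Formula α} {i : ℕ},
      (∀ a ∈ U \ {(X, i)}, a.1.eval v) → X.eval v → ∀ a ∈ U, a.1.eval v := by
    intro U X i hU hX a ha
    by_cases hai : a = (X, i)
    · rwa [hai]
    · exact hU a ⟨ha, hai⟩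
  induction d with
  | assume A n => exact h _ rfl
  | andI i dA dB dC ihA ihB ihC =>
    simp only [undischarged, mem_union, or_imp, forall_and] at h
    exact ihC (discharge h.2 ⟨ihA h.1.1, ihB h.1.2⟩)
  | @andE A B C i j dM dC ihM ihC =>
    simp only [undischarged, mem_union, or_imp, forall_and] at h
    have hM : A.eval v ∧ B.eval v := ihM h.1
    refine ihC (discharge (X := A) (i := i) (discharge (X := B) (i := j) ?_ hM.2) hM.1)
    rw [sdiff_sdiff]
    exact h.2
  | orIl i dA dC ihA ihC =>
    simp only [undischarged, mem_union, or_imp, forall_and] at h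
    exact ihC (discharge h.2 (Or.inl (ihA h.1)))
  | orIr i dB dC ihB ihC =>
    simp only [undischarged, mem_union, or_imp, forall_and] at h
    exact ihC (discharge h.2 (Or.inr (ihB h.1)))
  | orE i j dM dC₁ dC₂ ihM ih₁ ih₂ =>
    simp only [undischarged, mem_union, or_imp, forall_and] at h
    rcases ihM h.1.1 with hA | hB
    · exact ih₁ (discharge h.1.2 hA)
    · exact ih₂ (discharge h.2 hB)
  | impI i dB dC ihB ihC =>
    simp only [undischarged, mem_union, or_imp, forall_and] at h
    exact ihC (discharge h.2 fun _ => ihB h.1)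
  | @tr A B C i j dC₁ dC₂ ih₁ ih₂ =>
    simp only [undischarged, mem_union, or_imp, forall_and] at h
    by_cases hA : A.eval v
    · exact ih₁ (discharge h.1 hA)
    · exact ih₂ (discharge h.2 fun hA' => absurd hA' hA)
  | impE i dM dA dC ihM ihA ihC =>
    simp only [undischarged, mem_union, or_imp, forall_and] at h
    exact ihC (discharge h.2 (ihM h.1.1 (ihA h.1.2)))
  | @negI A C i j dC₁ dC₂ ih₁ ih₂ =>
    simp only [undischarged, mem_union, or_imp, forall_and] at h
    by_cases hA : A.eval v
    · exact ih₁ (discharge h.1 hA)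
    · exact ih₂ (discharge h.2 hA)
  | negE dM dA ihM ihA =>
    simp only [undischarged, mem_union, or_imp, forall_and] at h
    exact absurd (ihA h.2) (ihM h.1)

theorem entails {C : Formula α} (d : Deduction C) :
    Entails (Prod.fst '' d.undischarged) C :=
  fun v hv => d.eval_of_eval_undischarged v fun _ ha => hv _ (mem_image_of_mem _ ha)

end Deduction

/-! ### Derivability within a set of formulas, without vacuous discharge -/

/-- The assumption classes of the formulas in `Γ`, where `ℓ` assigns to each formula the only label
that it may carry. -/
def classes (ℓ : Formula α → ℕ) (Γ : Set (Formula α)) : Set (Formula α × ℕ) :=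
  {a | a.1 ∈ Γ ∧ a.2 = ℓ a.1}

/-- `Derivable ℓ S Γ C` means that `C` has a deduction without vacuous discharge, whose undischarged
assumptions belong to `Γ` and are labelled by `ℓ`, and on which all formulas belong to `S`. -/
def Derivable (ℓ : Formula α → ℕ) (S Γ : Set (Formula α)) (C : Formula α) : Prop :=
  ∃ e : Deduction C, e.NoVacuousDischarge ∧ e.undischarged ⊆ classes ℓ Γ ∧ e.formulas ⊆ S

theorem classes_insert_diff (ℓ : Formula α → ℕ) (X : Formula α) (Γ : Set (Formula α)) :
    classes ℓ (insert X Γ) \ {(X, ℓ X)} ⊆ classes ℓ Γ := by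
  rintro ⟨Y, n⟩ ⟨⟨rfl | hY, hn⟩, h⟩
  · obtain rfl : n = ℓ Y := hn
    exact absurd rfl h
  · exact ⟨hY, hn⟩

namespace Derivable

variable {ℓ : Formula α → ℕ} {S Γ Δ : Set (Formula α)} {A B C X : Formula α}

theorem of_mem (hX : X ∈ Γ) (hS : X ∈ S) : Derivable ℓ S Γ X := by
  refine ⟨.assume X (ℓ X), trivial, ?_, ?_⟩
  · rintro _ rfl
    exact ⟨hX, rfl⟩
  · rintro _ rfl
    exact hS

theorem mono (h : Γ ⊆ Δ) : Derivable ℓ S Γ C → Derivable ℓ S Δ C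
  | ⟨e, hv, hu, hf⟩ => ⟨e, hv, fun _ ha => ⟨h (hu ha).1, (hu ha).2⟩, hf⟩

/-- Either the additional assumption is superfluous, or it is used and can be discharged without
this being vacuous. -/
theorem insert_cases : Derivable ℓ S (insert X Γ) C → Derivable ℓ S Γ C ∨
    ∃ e : Deduction C, (X, ℓ X) ∈ e.undischarged ∧ e.NoVacuousDischarge ∧
      e.undischarged \ {(X, ℓ X)} ⊆ classes ℓ Γ ∧ e.formulas ⊆ S := by
  rintro ⟨e, hv, hu, hf⟩
  have hd := (sdiff_subset_sdiff_left hu).trans (classes_insert_diff ℓ X Γ)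
  by_cases hX : (X, ℓ X) ∈ e.undischarged
  · exact Or.inr ⟨e, hX, hv, hd, hf⟩
  · rw [sdiff_singleton_eq_self hX] at hd
    exact Or.inl ⟨e, hv, hd, hf⟩

theorem andI (hC : C ∈ S) (hA : Derivable ℓ S Γ A) (hB : Derivable ℓ S Γ B)
    (h : Derivable ℓ S (insert (.and A B) Γ) C) : Derivable ℓ S Γ C := by
  obtain h | ⟨e, hX, hv, hu, hf⟩ := h.insert_cases
  · exact h
  obtain ⟨a, hav, hau, haf⟩ := hA
  obtain ⟨b, hbv, hbu, hbf⟩ := hB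
  exact ⟨.andI (A := A) (B := B) (ℓ (.and A B)) a b e, ⟨hX, hav, hbv, hv⟩,
    union_subset (union_subset hau hbu) hu,
    insert_subset hC (union_subset (union_subset haf hbf) hf)⟩

theorem andE (hC : C ∈ S) (hM : Derivable ℓ S Γ (.and A B))
    (h : Derivable ℓ S (insert A (insert B Γ)) C) : Derivable ℓ S Γ C := by
  obtain ⟨e, hv, hu, hf⟩ := h
  have hd : e.undischarged \ {(A, ℓ A), (B, ℓ B)} ⊆ classes ℓ Γ := by
    rw [insert_eq, ← sdiff_sdiff]
    exact (sdiff_subset_sdiff_left ((sdiff_subset_sdiff_left hu).trans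
      (classes_insert_diff ℓ A _))).trans (classes_insert_diff ℓ B Γ)
  by_cases hX : (A, ℓ A) ∈ e.undischarged ∨ (B, ℓ B) ∈ e.undischarged
  · obtain ⟨m, hmv, hmu, hmf⟩ := hM
    exact ⟨.andE (ℓ A) (ℓ B) m e, ⟨hX, hmv, hv⟩, union_subset hmu hd,
      insert_subset hC (union_subset hmf hf)⟩
  · refine ⟨e, hv, fun a ha => hd ⟨ha, ?_⟩, hf⟩
    rintro (rfl | rfl)
    · exact hX (Or.inl ha)
    · exact hX (Or.inr ha)

theorem orIl (hC : C ∈ S) (hA : Derivable ℓ S Γ A)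
    (h : Derivable ℓ S (insert (.or A B) Γ) C) : Derivable ℓ S Γ C := by
  obtain h | ⟨e, hX, hv, hu, hf⟩ := h.insert_cases
  · exact h
  obtain ⟨a, hav, hau, haf⟩ := hA
  exact ⟨.orIl (B := B) (ℓ (.or A B)) a e, ⟨hX, hav, hv⟩, union_subset hau hu,
    insert_subset hC (union_subset haf hf)⟩

theorem orIr (hC : C ∈ S) (hB : Derivable ℓ S Γ B)
    (h : Derivable ℓ S (insert (.or A B) Γ) C) : Derivable ℓ S Γ C := by
  obtain h | ⟨e, hX, hv, hu, hf⟩ := h.insert_cases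
  · exact h
  obtain ⟨b, hbv, hbu, hbf⟩ := hB
  exact ⟨.orIr (A := A) (ℓ (.or A B)) b e, ⟨hX, hbv, hv⟩, union_subset hbu hu,
    insert_subset hC (union_subset hbf hf)⟩

theorem orE (hC : C ∈ S) (hM : Derivable ℓ S Γ (.or A B))
    (h₁ : Derivable ℓ S (insert A Γ) C) (h₂ : Derivable ℓ S (insert B Γ) C) :
    Derivable ℓ S Γ C := by
  obtain h | ⟨e₁, hX₁, hv₁, hu₁, hf₁⟩ := h₁.insert_cases
  · exact h
  obtain h | ⟨e₂, hX₂, hv₂, hu₂, hf₂⟩ := h₂.insert_cases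
  · exact h
  obtain ⟨m, hmv, hmu, hmf⟩ := hM
  exact ⟨.orE (ℓ A) (ℓ B) m e₁ e₂, ⟨hX₁, hX₂, hmv, hv₁, hv₂⟩,
    union_subset (union_subset hmu hu₁) hu₂,
    insert_subset hC (union_subset (union_subset hmf hf₁) hf₂)⟩

theorem impI (hC : C ∈ S) (hB : Derivable ℓ S Γ B)
    (h : Derivable ℓ S (insert (.imp A B) Γ) C) : Derivable ℓ S Γ C := by
  obtain h | ⟨e, hX, hv, hu, hf⟩ := h.insert_cases
  · exact h
  obtain ⟨b, hbv, hbu, hbf⟩ := hB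
  exact ⟨.impI (A := A) (ℓ (.imp A B)) b e, ⟨hX, hbv, hv⟩, union_subset hbu hu,
    insert_subset hC (union_subset hbf hf)⟩

theorem tr (hC : C ∈ S) (h₁ : Derivable ℓ S (insert A Γ) C)
    (h₂ : Derivable ℓ S (insert (.imp A B) Γ) C) : Derivable ℓ S Γ C := by
  obtain h | ⟨e₁, hX₁, hv₁, hu₁, hf₁⟩ := h₁.insert_cases
  · exact h
  obtain h | ⟨e₂, hX₂, hv₂, hu₂, hf₂⟩ := h₂.insert_cases
  · exact h
  exact ⟨.tr (A := A) (B := B) (ℓ A) (ℓ (.imp A B)) e₁ e₂, ⟨hX₁, hX₂, hv₁, hv₂⟩,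
    union_subset hu₁ hu₂,
    insert_subset hC (union_subset hf₁ hf₂)⟩

theorem impE (hC : C ∈ S) (hM : Derivable ℓ S Γ (.imp A B)) (hA : Derivable ℓ S Γ A)
    (h : Derivable ℓ S (insert B Γ) C) : Derivable ℓ S Γ C := by
  obtain h | ⟨e, hX, hv, hu, hf⟩ := h.insert_cases
  · exact h
  obtain ⟨m, hmv, hmu, hmf⟩ := hM
  obtain ⟨a, hav, hau, haf⟩ := hA
  exact ⟨.impE (ℓ B) m a e, ⟨hX, hmv, hav, hv⟩, union_subset (union_subset hmu hau) hu,
    insert_subset hC (union_subset (union_subset hmf haf) hf)⟩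

theorem negI (hC : C ∈ S) (h₁ : Derivable ℓ S (insert A Γ) C)
    (h₂ : Derivable ℓ S (insert (.neg A) Γ) C) : Derivable ℓ S Γ C := by
  obtain h | ⟨e₁, hX₁, hv₁, hu₁, hf₁⟩ := h₁.insert_cases
  · exact h
  obtain h | ⟨e₂, hX₂, hv₂, hu₂, hf₂⟩ := h₂.insert_cases
  · exact h
  exact ⟨.negI (A := A) (ℓ A) (ℓ (.neg A)) e₁ e₂, ⟨hX₁, hX₂, hv₁, hv₂⟩,
    union_subset hu₁ hu₂,
    insert_subset hC (union_subset hf₁ hf₂)⟩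

theorem negE (hC : C ∈ S) (hM : Derivable ℓ S Γ (.neg A)) (hA : Derivable ℓ S Γ A) :
    Derivable ℓ S Γ C := by
  obtain ⟨m, hmv, hmu, hmf⟩ := hM
  obtain ⟨a, hav, hau, haf⟩ := hA
  exact ⟨.negE m a, ⟨hmv, hav⟩, union_subset hmu hau,
    insert_subset hC (union_subset hmf haf)⟩

end Derivable

/-! ### Completeness within a set of formulas -/

/-- `Unprovable ℓ S C Δ` means that `Δ` is a subset of `S` from which `C` is not derivable. -/
def Unprovable (ℓ : Formula α → ℕ) (S : Set (Formula α)) (C : Formula α)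
    (Δ : Set (Formula α)) : Prop :=
  Δ ⊆ S ∧ ¬ Derivable ℓ S Δ C

variable {ℓ : Formula α → ℕ} {S Γ Δ : Set (Formula α)} {C : Formula α}

theorem Unprovable.derivable_insert (hΔ : Maximal (Unprovable ℓ S C) Δ) {X : Formula α}
    (hX : X ∈ S) (hXΔ : X ∉ Δ) : Derivable ℓ S (insert X Δ) C := by
  by_contra h
  exact hXΔ (hΔ.le_of_ge ⟨insert_subset hX hΔ.prop.1, h⟩ (subset_insert X Δ) (mem_insert X Δ))

/-- The truth lemma: a maximal subset of `S` from which `C` is not derivable consists of the formulas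
in `S` that are true under the valuation making true the atomic formulas it contains. -/
theorem Unprovable.mem_iff_eval (hS : ∀ X ∈ S, X.subformulas ⊆ S) (hC : C ∈ S)
    (hΔ : Maximal (Unprovable ℓ S C) Δ) {X : Formula α} (hX : X ∈ S) :
    X ∈ Δ ↔ X.eval fun p => Formula.atom p ∈ Δ := by
  have hnot := hΔ.prop.2
  have hmem : ∀ {Y}, Y ∈ Δ → Derivable ℓ S Δ Y := fun hY =>
    .of_mem hY (hΔ.prop.1 hY)
  have hins : ∀ {Y}, Y ∈ S → Y ∉ Δ → Derivable ℓ S (insert Y Δ) C := derivable_insert hΔ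
  induction X with
  | atom p => exact Iff.rfl
  | neg A ih =>
    have hA : A ∈ S := hS _ hX (Or.inr A.self_mem_subformulas)
    replace ih : A ∈ Δ ↔ _ := ih hA
    rw [eval, ← ih]
    refine ⟨fun h hAΔ => hnot (.negE hC (hmem h) (hmem hAΔ)), fun h => ?_⟩
    by_contra hn
    exact hnot (.negI hC (hins hA h) (hins hX hn))
  | imp A B ihA ihB =>
    have hA : A ∈ S := hS _ hX (Or.inr (Or.inl A.self_mem_subformulas))
    have hB : B ∈ S := hS _ hX (Or.inr (Or.inr B.self_mem_subformulas))
    replace ihA : A ∈ Δ ↔ _ := ihA hA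
    replace ihB : B ∈ Δ ↔ _ := ihB hB
    rw [eval, ← ihA, ← ihB]
    refine ⟨fun h hAΔ => ?_, fun h => ?_⟩ <;> by_contra hn
    · exact hnot (.impE hC (hmem h) (hmem hAΔ) (hins hB hn))
    · by_cases hAΔ : A ∈ Δ
      · exact hnot (.impI hC (hmem (h hAΔ)) (hins hX hn))
      · exact hnot (.tr hC (hins hA hAΔ) (hins hX hn))
  | and A B ihA ihB =>
    have hA : A ∈ S := hS _ hX (Or.inr (Or.inl A.self_mem_subformulas))
    have hB : B ∈ S := hS _ hX (Or.inr (Or.inr B.self_mem_subformulas))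
    replace ihA : A ∈ Δ ↔ _ := ihA hA
    replace ihB : B ∈ Δ ↔ _ := ihB hB
    rw [eval, ← ihA, ← ihB]
    refine ⟨fun h => ⟨?_, ?_⟩, fun h => ?_⟩ <;> by_contra hn
    · exact hnot (.andE hC (hmem h) ((hins hA hn).mono (insert_subset_insert (subset_insert _ _))))
    · exact hnot (.andE hC (hmem h) ((hins hB hn).mono (subset_insert _ _)))
    · exact hnot (.andI hC (hmem h.1) (hmem h.2) (hins hX hn))
  | or A B ihA ihB =>
    have hA : A ∈ S := hS _ hX (Or.inr (Or.inl A.self_mem_subformulas))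
    have hB : B ∈ S := hS _ hX (Or.inr (Or.inr B.self_mem_subformulas))
    replace ihA : A ∈ Δ ↔ _ := ihA hA
    replace ihB : B ∈ Δ ↔ _ := ihB hB
    rw [eval, ← ihA, ← ihB]
    refine ⟨fun h => ?_, fun h => ?_⟩ <;> by_contra hn
    · rw [not_or] at hn
      exact hnot (.orE hC (hmem h) (hins hA hn.1) (hins hB hn.2))
    · rcases h with h | h
      · exact hnot (.orIl hC (hmem h) (hins hX hn))
      · exact hnot (.orIr hC (hmem h) (hins hX hn))

/-- Completeness, within a finite set of formulas that is closed under subformulas. -/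
theorem Derivable.of_entails (hfin : S.Finite) (hS : ∀ X ∈ S, X.subformulas ⊆ S) (hC : C ∈ S)
    (hΓ : Γ ⊆ S) (h : Entails Γ C) : Derivable ℓ S Γ C := by
  by_contra hn
  have hfin' : {Δ | Unprovable ℓ S C Δ}.Finite := hfin.finite_subsets.subset fun _ hΔ => hΔ.1
  obtain ⟨Δ, hΓΔ, hΔ⟩ := hfin'.exists_le_maximal (show Γ ∈ {Δ | Unprovable ℓ S C Δ} from ⟨hΓ, hn⟩)
  have hCΔ : C ∈ Δ := (Unprovable.mem_iff_eval hS hC hΔ hC).2 <|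
    h _ fun X hX => (Unprovable.mem_iff_eval hS hC hΔ (hΓ hX)).1 (hΓΔ hX)
  exact hΔ.prop.2 (.of_mem hCΔ hC)

/-! ### Deductions with the subformula property -/

namespace Deduction

variable {A : Formula α}

theorem exists_noVacuousDischarge_subformulaProperty (d : Deduction A) :
    ∃ e : Deduction A, e.NoVacuousDischarge ∧ e.undischarged ⊆ d.undischarged ∧
      e.SubformulaProperty := by
  have hfin : (Prod.fst '' d.undischarged).Finite := d.finite_undischarged.image _
  have hfin' : {Γ | Γ ⊆ Prod.fst '' d.undischarged ∧ Entails Γ A}.Finite :=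
    hfin.finite_subsets.subset fun _ hΓ => hΓ.1
  obtain ⟨Γ, -, hΓ⟩ := hfin'.exists_le_minimal
    (show Prod.fst '' d.undischarged ∈ {Γ | Γ ⊆ Prod.fst '' d.undischarged ∧ Entails Γ A} from
      ⟨Subset.rfl, d.entails⟩)
  -- For each assumption formula of `d`, one of the labels that it carries in `d`.
  have hlabel : ∀ X : Formula α, ∃ n : ℕ, X ∈ Prod.fst '' d.undischarged →
      (X, n) ∈ d.undischarged := by
    intro X
    by_cases hX : X ∈ Prod.fst '' d.undischarged
    · obtain ⟨⟨Y, n⟩, hY, rfl⟩ := hX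
      exact ⟨n, fun _ => hY⟩
    · exact ⟨0, fun h => absurd h hX⟩
  choose ℓ hℓ using hlabel
  have hsub := subset_closure Γ A
  obtain ⟨e, hv, hu, hf⟩ := Derivable.of_entails (ℓ := ℓ)
    (finite_closure (hfin.subset hΓ.prop.1) A) (fun X hX => subformulas_subset_closure hX)
    (hsub (mem_insert A Γ)) ((subset_insert A Γ).trans hsub) hΓ.prop.2
  have heΓ : Prod.fst '' e.undischarged ⊆ Γ := image_subset_iff.2 fun a ha => (hu ha).1
  have hΓe : Γ ⊆ Prod.fst '' e.undischarged :=
    hΓ.le_of_le ⟨heΓ.trans hΓ.prop.1, e.entails⟩ heΓ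
  refine ⟨e, hv, ?_, ?_⟩
  · rintro ⟨X, n⟩ ha
    obtain ⟨hX, rfl⟩ : X ∈ Γ ∧ n = ℓ X := hu ha
    exact hℓ X (hΓ.prop.1 hX)
  · intro F hF
    obtain ⟨Y, rfl | hY, hFY⟩ := mem_iUnion₂.1 (hf hF)
    · exact Or.inl hFY
    · obtain ⟨a, ha, rfl⟩ := hΓe hY
      exact Or.inr ⟨a, ha, hFY⟩

/-- Any assumption class can be added to a deduction, and nothing else: infer the conclusion from the
new assumption `B` and the given deduction by implication introduction, discharging a class `B ⊃ B`
with a label that does not occur. -/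
theorem exists_undischarged_eq_insert (e : Deduction A) (b : Formula α × ℕ) :
    ∃ e' : Deduction A, e'.undischarged = insert b e.undischarged ∧
      e'.formulas = insert b.1 e.formulas := by
  obtain ⟨i, hi⟩ := (e.finite_undischarged.image Prod.snd).exists_notMem
  have hi' : (Formula.imp b.1 b.1, i) ∉ e.undischarged := fun h => hi (mem_image_of_mem _ h)
  have hA : A ∈ e.formulas := by
    cases e <;> simp [formulas]
  refine ⟨.impI (A := b.1) i (.assume b.1 b.2) e, ?_, ?_⟩
  · simp only [undischarged, sdiff_singleton_eq_self hi', singleton_union]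
  · simp only [formulas, singleton_union]
    exact insert_eq_of_mem (mem_insert_of_mem _ hA)

theorem exists_undischarged_eq_union (e : Deduction A) {U : Set (Formula α × ℕ)}
    (hU : U.Finite) :
    ∃ e' : Deduction A, e'.undischarged = U ∪ e.undischarged ∧
      e'.formulas = Prod.fst '' U ∪ e.formulas := by
  induction U, hU using Set.Finite.induction_on with
  | empty => exact ⟨e, by simp⟩
  | insert _ _ ih =>
    obtain ⟨e₁, hu₁, hf₁⟩ := ih
    obtain ⟨e₂, hu₂, hf₂⟩ := e₁.exists_undischarged_eq_insert _
    exact ⟨e₂, by rw [hu₂, hu₁, insert_union], by rw [hf₂, hf₁, image_insert_eq, insert_union]⟩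

end Deduction

end SystemC

theorem mainTheorem5 {α : Type u} {A : SystemC.Formula α} (d : SystemC.Deduction A) :
    (∃ e : SystemC.Deduction A,
      e.undischarged = d.undischarged ∧ e.SubformulaProperty) ∧
    (∃ e : SystemC.Deduction A,
      e.NoVacuousDischarge ∧ e.undischarged ⊆ d.undischarged ∧ e.SubformulaProperty) := by
  obtain ⟨e, hv, hu, hs⟩ := d.exists_noVacuousDischarge_subformulaProperty
  refine ⟨?_, e, hv, hu, hs⟩
  obtain ⟨e', hu', hf'⟩ := e.exists_undischarged_eq_union d.finite_undischarged
  rw [Set.union_eq_self_of_subset_right hu] at hu'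
  refine ⟨e', hu', fun F hF => ?_⟩
  rw [hf'] at hF
  rw [hu']
  obtain ⟨a, ha, rfl⟩ | hF := hF
  · exact Or.inr ⟨a, ha, a.1.self_mem_subformulas⟩
  · exact (hs F hF).imp_right fun ⟨a, ha, h⟩ => ⟨a, hu ha, h⟩
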